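/- Let $n\ge 1$ be an integer, let $\mathbb{S}^n\subset\mathbb{R}^{n+1}$ be the Euclidean unit sphere, and let $d$ be the angular distance on $\mathbb{S}^n$, that is, $d(a,b)\in[0,\pi]$ is the angle between the unit vectors $a$ and $b$. For a continuous map $f\colon\mathbb{S}^n\to\mathbb{R}^{n+1}$, call two distinct points $a,b\in\mathbb{S}^n$ topological $f$-neighbors if either $f(a)=f(b)$ or some path in $\mathbb{R}^{n+1}$ with endpoints $f(a)$ and $f(b)$ intersects $f(\mathbb{S}^n)$ only at these two points. Let $\Omega_f^{top}$ be the set of all numbers $d(a,b)$, where $a,b\in\mathbb{S}^n$ are topological $f$-neighbors. Then for every finite set $F\subset\mathbb{R}$ there exists a continuous map $f_F\colon\mathbb{S}^n\to\mathbb{R}^{n+1}$ such that $F\cap\Omega_{f_F}^{top}=\varnothing$. -/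

import Mathlib

/-- The Euclidean unit sphere `𝕊ⁿ` in the Euclidean space `ℝⁿ⁺¹`. -/
abbrev UnitSphere (n : ℕ) : Type :=
  Metric.sphere (0 : EuclideanSpace ℝ (Fin (n + 1))) 1

/-- The angular distance on `𝕊ⁿ`: the angle, in `[0, π]`, between two unit vectors. -/
noncomputable def angularDist {n : ℕ} (a b : UnitSphere n) : ℝ :=
  InnerProductGeometry.angle (a : EuclideanSpace ℝ (Fin (n + 1))) b

/-- Distinct points `a` and `b` are topological `f`-neighbors if either `f a = f b` or some path in
`ℝᵐ` with endpoints at `f a` and `f b` meets the image of `f` only at these two points. -/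
def IsTopologicalNeighbors {M : Type*} {m : ℕ} (f : M → EuclideanSpace ℝ (Fin m)) (a b : M) :
    Prop :=
  a ≠ b ∧
    (f a = f b ∨ ∃ γ : Path (f a) (f b), Set.range γ ∩ Set.range f = {f a, f b})

/-- The set `Ω_f^top` of the distances, with respect to the distance function `d` on `M`, that are
realized as distances between topological `f`-neighbors. -/
def topologicalNeighborDistances {M : Type*} {m : ℕ} (d : M → M → ℝ)
    (f : M → EuclideanSpace ℝ (Fin m)) : Set ℝ :=
  {r | ∃ a b : M, IsTopologicalNeighbors f a b ∧ d a b = r}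

/-! The map `f` is the identity except on finitely many tiny disjoint caps, all near one point `p`.
Finitely many closed balls cover the sphere; the cap centred at `N x` is stretched along a curve
that runs to `x` and fills the ball around `x`. So every point outside the caps is fixed and
interior to the image, and a path meeting the image only at its endpoints cannot leave it
(`eq_of_path_range_inter_range`). Two points in caps are too close to realize a nonzero distance in
`F`.

It remains to exclude `f a = f b` with `a` in a cap and `b` outside. A single cap would fail, since
its curve would sweep over points at forbidden distance from it; instead `N x` is chosen so that no
forbidden distance occurs between it and the ball around `x`
(`exists_finite_cover_angularDist_notMem`). Compactness makes this uniform over a small cap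
(`eventually_lt_dist_of_angularDist_mem`). -/

open Metric Set in
/-- A continuous curve that starts at `p`, moves along a segment to `x`, and then fills a closed
ball around `x`. -/
theorem exists_continuous_filling_closedBall {m : ℕ} (p x : EuclideanSpace ℝ (Fin m)) {δ : ℝ}
    (hδ : 0 < δ) :
    ∃ Γ : ℝ → EuclideanSpace ℝ (Fin m), Continuous Γ ∧ Γ 0 = p ∧
      closedBall x δ ⊆ Γ '' Icc 0 1 ∧ range Γ ⊆ segment ℝ p x ∪ closedBall x δ := by
  have : Nonempty (closedBall x δ) := ⟨⟨x, mem_closedBall_self hδ.le⟩⟩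
  have : CompactSpace (closedBall x δ) := isCompact_iff_compactSpace.1 (isCompact_closedBall x δ)
  -- The Cantor set maps onto the ball; Tietze extends this map to `ℝ` with values still in the
  -- ball.
  obtain ⟨h, hc, hs⟩ := exists_nat_bool_continuous_surjective_of_compact (closedBall x δ)
  have : TietzeExtension (closedBall x δ) := Metric.instTietzeExtensionClosedBall ℝ x hδ
  obtain ⟨g, hg⟩ := ContinuousMap.exists_restrict_eq isClosed_cantorSet
    (⟨h ∘ cantorSetHomeomorphNatToBool, by fun_prop⟩ : C(cantorSet, closedBall x δ))
  have hgs : ∀ y ∈ closedBall x δ, ∃ t ∈ Icc (0 : ℝ) 1, (g t : EuclideanSpace ℝ (Fin m)) = y := by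
    intro y hy
    obtain ⟨u, hu⟩ := hs ⟨y, hy⟩
    refine ⟨cantorSetHomeomorphNatToBool.symm u,
      cantorSet_subset_unitInterval (cantorSetHomeomorphNatToBool.symm u).2, ?_⟩
    have := DFunLike.congr_fun hg (cantorSetHomeomorphNatToBool.symm u)
    simp only [ContinuousMap.restrict_apply, ContinuousMap.coe_mk, Function.comp_apply,
      Homeomorph.apply_symm_apply, hu] at this
    rw [this]
  obtain ⟨γ₁, h₁⟩ := ((convex_segment (𝕜 := ℝ) p x).isPathConnected
    ⟨p, left_mem_segment ℝ p x⟩).joinedIn p (left_mem_segment ℝ p x) x (right_mem_segment ℝ p x)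
  obtain ⟨γ₂, h₂⟩ := ((convex_closedBall x δ).isPathConnected
    ⟨x, mem_closedBall_self hδ.le⟩).joinedIn x (mem_closedBall_self hδ.le) (g 0) (g 0).2
  let γ₃ : Path (g 0 : EuclideanSpace ℝ (Fin m)) (g 1) :=
    ⟨⟨fun t => g t, by fun_prop⟩, by simp, by simp⟩
  have hr : range ((γ₁.trans γ₂).trans γ₃).extend = (range γ₁ ∪ range γ₂) ∪ range γ₃ := by
    rw [Path.extend_range, Path.trans_range, Path.trans_range]
  refine ⟨((γ₁.trans γ₂).trans γ₃).extend, Path.continuous_extend _, Path.extend_zero _, ?_, ?_⟩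
  · intro y hy
    obtain ⟨t, ht, rfl⟩ := hgs y hy
    have : ((g t : EuclideanSpace ℝ (Fin m))) ∈ range ((γ₁.trans γ₂).trans γ₃) := by
      rw [Path.trans_range]
      exact Or.inr ⟨⟨t, ht⟩, rfl⟩
    obtain ⟨s, hs⟩ := this
    exact ⟨s, s.2, by rw [← hs]; simp [Path.extend_apply]⟩
  · rw [hr]
    rintro y ((⟨t, rfl⟩ | ⟨t, rfl⟩) | ⟨t, rfl⟩)
    · exact Or.inl (h₁ t)
    · exact Or.inr (h₂ t)
    · exact Or.inr (g t).2

/-! ### Angular distance and topology of the sphere -/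

theorem UnitSphere.norm_coe {n : ℕ} (a : UnitSphere n) :
    ‖(a : EuclideanSpace ℝ (Fin (n + 1)))‖ = 1 := by
  simp

theorem UnitSphere.coe_ne_zero {n : ℕ} (a : UnitSphere n) :
    (a : EuclideanSpace ℝ (Fin (n + 1))) ≠ 0 := by
  rw [← norm_ne_zero_iff, a.norm_coe]
  exact one_ne_zero

theorem continuous_angularDist {n : ℕ} :
    Continuous fun q : UnitSphere n × UnitSphere n => angularDist q.1 q.2 := by
  unfold angularDist
  refine continuous_iff_continuousAt.2 fun q => ?_
  exact ContinuousAt.comp (f := fun q : UnitSphere n × UnitSphere n =>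
    ((q.1 : EuclideanSpace ℝ (Fin (n + 1))), (q.2 : EuclideanSpace ℝ (Fin (n + 1)))))
    (InnerProductGeometry.continuousAt_angle q.1.coe_ne_zero q.2.coe_ne_zero)
    (Continuous.continuousAt (by fun_prop))

theorem angularDist_comm {n : ℕ} (a b : UnitSphere n) : angularDist a b = angularDist b a :=
  InnerProductGeometry.angle_comm _ _

theorem angularDist_self {n : ℕ} (a : UnitSphere n) : angularDist a a = 0 :=
  InnerProductGeometry.angle_self a.coe_ne_zero

theorem eq_of_angularDist_eq_zero {n : ℕ} {a b : UnitSphere n} (h : angularDist a b = 0) :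
    a = b := by
  have := (InnerProductGeometry.inner_eq_mul_norm_iff_angle_eq_zero a.coe_ne_zero
    b.coe_ne_zero).2 h
  rw [a.norm_coe, b.norm_coe, mul_one] at this
  exact Subtype.ext ((inner_eq_one_iff_of_norm_eq_one a.norm_coe b.norm_coe).1 this)

theorem inner_eq_cos_angularDist {n : ℕ} (a b : UnitSphere n) :
    inner ℝ (a : EuclideanSpace ℝ (Fin (n + 1))) b = Real.cos (angularDist a b) := by
  rw [angularDist, InnerProductGeometry.cos_angle, a.norm_coe, b.norm_coe]
  simp

theorem one_lt_rank_euclideanSpace_succ {n : ℕ} (hn : 1 ≤ n) :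
    1 < Module.rank ℝ (EuclideanSpace ℝ (Fin (n + 1))) := by
  rw [← Module.finrank_eq_rank, finrank_euclideanSpace_fin]
  exact_mod_cast Nat.lt_succ_of_le hn

theorem UnitSphere.preconnectedSpace {n : ℕ} (hn : 1 ≤ n) : PreconnectedSpace (UnitSphere n) :=
  isPreconnected_iff_preconnectedSpace.1
    (isPreconnected_sphere (one_lt_rank_euclideanSpace_succ hn) _ _)

/-- No angular distance function `angularDist x` is locally constant anywhere. -/
theorem exists_angularDist_notMem_of_isOpen {n : ℕ} (hn : 1 ≤ n) {F : Set ℝ} (hF : F.Finite)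
    (x : UnitSphere n) {W : Set (UnitSphere n)} (hW : IsOpen W) (hne : W.Nonempty) :
    ∃ N ∈ W, angularDist x N ∉ F := by
  by_contra! hcon
  obtain ⟨p, hp⟩ := hne
  -- Move `p` along the great circle in direction `v`: the distance to `x` varies continuously in a
  -- finite set, hence is constant.
  have key : ∀ v : EuclideanSpace ℝ (Fin (n + 1)), ‖v‖ = 1 →
      inner ℝ (p : EuclideanSpace ℝ (Fin (n + 1))) v = 0 →
      inner ℝ (x : EuclideanSpace ℝ (Fin (n + 1))) p = 0 ∧
        inner ℝ (x : EuclideanSpace ℝ (Fin (n + 1))) v = 0 := by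
    intro v hv hpv
    set α := inner ℝ (x : EuclideanSpace ℝ (Fin (n + 1))) p with hα
    set β := inner ℝ (x : EuclideanSpace ℝ (Fin (n + 1))) v with hβ
    have hsq : ∀ t : ℝ, ‖(p : EuclideanSpace ℝ (Fin (n + 1))) + t • v‖ ^ 2 = 1 + t ^ 2 := by
      intro t
      rw [norm_add_sq_real, inner_smul_right, hpv, norm_smul, hv, p.norm_coe]
      simp
    have hpos : ∀ t : ℝ, ‖(p : EuclideanSpace ℝ (Fin (n + 1))) + t • v‖ ≠ 0 := by
      intro t h
      have := hsq t
      rw [h] at this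
      nlinarith [sq_nonneg t]
    let c : ℝ → UnitSphere n := fun t =>
      ⟨‖(p : EuclideanSpace ℝ (Fin (n + 1))) + t • v‖⁻¹ •
        ((p : EuclideanSpace ℝ (Fin (n + 1))) + t • v), by
        rw [mem_sphere_zero_iff_norm, norm_smul, norm_inv, norm_norm, inv_mul_cancel₀ (hpos t)]⟩
    have hc : Continuous c := by
      refine Continuous.subtype_mk (Continuous.smul (Continuous.inv₀ (by fun_prop) hpos)
        (by fun_prop)) _
    have hc0 : c 0 = p := by
      apply Subtype.ext
      simp [c]
    obtain ⟨δ, hδ, hball⟩ := Metric.isOpen_iff.1 (hW.preimage hc) 0 (by simpa [hc0] using hp)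
    have hsub : ((fun t => angularDist x (c t)) '' Metric.ball 0 δ).Subsingleton := by
      by_contra hnt
      rw [Set.not_subsingleton_iff] at hnt
      refine ((convex_ball (0 : ℝ) δ).isPreconnected.image _ ?_).infinite_of_nontrivial hnt ?_
      · exact (continuous_angularDist.comp
          (continuous_const.prodMk hc)).continuousOn
      · refine hF.subset ?_
        rintro _ ⟨t, ht, rfl⟩
        exact hcon _ (hball ht)
    have heq : ∀ t ∈ Metric.ball (0 : ℝ) δ, (α + t * β) ^ 2 = α ^ 2 * (1 + t ^ 2) := by
      intro t ht
      have h1 : angularDist x (c t) = angularDist x (c 0) :=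
        hsub ⟨t, ht, rfl⟩ ⟨0, Metric.mem_ball_self hδ, rfl⟩
      have h2 : inner ℝ (x : EuclideanSpace ℝ (Fin (n + 1))) (c t) = α := by
        rw [inner_eq_cos_angularDist, h1, ← inner_eq_cos_angularDist, hc0]
      have h3 : α + t * β = α * ‖(p : EuclideanSpace ℝ (Fin (n + 1))) + t • v‖ := by
        nth_rewrite 2 [← h2]
        simp only [c, inner_smul_right, inner_add_right, ← hα, ← hβ]
        field_simp [hpos t]
      rw [h3, mul_pow, hsq]
    -- Subtracting the identities at `±δ / 2` gives `α * β = 0`; adding them gives `β ^ 2 = α ^ 2`.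
    have h1 := heq (δ / 2) (by simp [abs_of_pos hδ, hδ])
    have h2 := heq (-(δ / 2)) (by simp [abs_of_pos hδ, hδ])
    have h3 : α * β = 0 := by
      have : δ * (α * β) = 0 := by linarith
      exact (mul_eq_zero.1 this).resolve_left hδ.ne'
    have h4 : β ^ 2 = α ^ 2 := by
      have : δ ^ 2 * (β ^ 2 - α ^ 2) = 0 := by linarith
      exact sub_eq_zero.1 ((mul_eq_zero.1 this).resolve_left (by positivity))
    rcases mul_eq_zero.1 h3 with h | h
    · rw [h] at h4
      exact ⟨h, by simpa using h4⟩
    · rw [h] at h4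
      exact ⟨by simpa using h4.symm, h⟩
  have hxp : inner ℝ (x : EuclideanSpace ℝ (Fin (n + 1))) p = 0 := by
    have hfr : Module.finrank ℝ (EuclideanSpace ℝ (Fin (n + 1))) = n + 1 :=
      finrank_euclideanSpace_fin
    have hlt : Module.finrank ℝ (ℝ ∙ (p : EuclideanSpace ℝ (Fin (n + 1)))) <
        Module.finrank ℝ (EuclideanSpace ℝ (Fin (n + 1))) := by
      rw [finrank_span_singleton p.coe_ne_zero, hfr]
      omega
    have hbot : (ℝ ∙ (p : EuclideanSpace ℝ (Fin (n + 1))))ᗮ ≠ ⊥ := by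
      rw [Ne, Submodule.orthogonal_eq_bot_iff]
      intro h
      rw [h, finrank_top] at hlt
      exact lt_irrefl _ hlt
    obtain ⟨w, hw, hw0⟩ := Submodule.exists_mem_ne_zero_of_ne_bot hbot
    refine (key (‖w‖⁻¹ • w) ?_ ?_).1
    · rw [norm_smul, norm_inv, norm_norm, inv_mul_cancel₀ (norm_ne_zero_iff.2 hw0)]
    · rw [inner_smul_right, Submodule.mem_orthogonal_singleton_iff_inner_right.1 hw, mul_zero]
  -- Since `x` is orthogonal to `p`, it is itself an admissible direction `v`.
  have := (key x x.norm_coe (by rw [real_inner_comm]; exact hxp)).2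
  rw [real_inner_self_eq_norm_sq, x.norm_coe] at this
  norm_num at this

theorem UnitSphere.infinite_of_isOpen {n : ℕ} (hn : 1 ≤ n) {W : Set (UnitSphere n)}
    (hW : IsOpen W) (hne : W.Nonempty) : W.Infinite := by
  obtain ⟨p, hp⟩ := hne
  have := UnitSphere.preconnectedSpace hn
  have : Nontrivial (UnitSphere n) := by
    refine ⟨p, -p, fun h => p.coe_ne_zero ?_⟩
    have h' : (p : EuclideanSpace ℝ (Fin (n + 1))) = -p := congrArg Subtype.val h
    have h2 : (2 : ℝ) • (p : EuclideanSpace ℝ (Fin (n + 1))) = 0 := by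
      rw [two_smul]
      nth_rewrite 1 [h']
      exact neg_add_cancel _
    exact (smul_eq_zero.1 h2).resolve_left two_ne_zero
  have : ConnectedSpace (UnitSphere n) := { toNonempty := ⟨p⟩ }
  exact infinite_of_mem_nhds p (hW.mem_nhds hp)

theorem UnitSphere.exists_dist_eq {n : ℕ} (hn : 1 ≤ n) (p : UnitSphere n) {r : ℝ} (h0 : 0 ≤ r)
    (h2 : r ≤ 2) : ∃ a : UnitSphere n, dist a p = r := by
  have := UnitSphere.preconnectedSpace hn
  have hneg : dist (-p) p = 2 := by
    have h : ((-p : UnitSphere n) : EuclideanSpace ℝ (Fin (n + 1))) - p =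
        (-2 : ℝ) • (p : EuclideanSpace ℝ (Fin (n + 1))) := by
      rw [coe_neg_sphere]
      module
    rw [Subtype.dist_eq, dist_eq_norm, h, norm_smul, p.norm_coe]
    norm_num
  have := intermediate_value_univ p (-p) (f := fun a => dist a p) (by fun_prop)
  exact this ⟨by simpa using h0, by rw [hneg]; exact h2⟩

/-! ### Choice of the covering balls and cap centres -/

/-- An injective choice of elements from finitely many infinite sets. -/
theorem Finset.exists_injOn_forall_mem_of_infinite {ι α : Type*} [Nonempty α]
    (t : Finset ι) (S : ι → Set α) (hS : ∀ i ∈ t, (S i).Infinite) :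
    ∃ g : ι → α, Set.InjOn g t ∧ ∀ i ∈ t, g i ∈ S i := by
  classical
  induction t using Finset.induction_on with
  | empty => exact ⟨fun _ => Classical.arbitrary α, by simp, by simp⟩
  | insert j t hj ih => 
    obtain ⟨g, hg, hgS⟩ := ih fun i hi => hS i (Finset.mem_insert_of_mem hi)
    obtain ⟨y, hy, hyt⟩ := (hS j (Finset.mem_insert_self j t)).exists_notMem_finset (t.image g)
    have hne : ∀ i ∈ t, i ≠ j := fun i hi h => hj (h ▸ hi)
    have hy' : ∀ i ∈ t, g i ≠ y := fun i hi h => hyt (Finset.mem_image.2 ⟨i, hi, h⟩)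
    refine ⟨Function.update g j y, ?_, ?_⟩
    · intro a ha b hb hab
      simp only [Finset.coe_insert, Set.mem_insert_iff, Finset.mem_coe] at ha hb
      rcases ha with rfl | ha <;> rcases hb with rfl | hb
      · rfl
      · rw [Function.update_self, Function.update_of_ne (hne b hb)] at hab
        exact (hy' b hb hab.symm).elim
      · rw [Function.update_self, Function.update_of_ne (hne a ha)] at hab
        exact (hy' a ha hab).elim
      · rw [Function.update_of_ne (hne a ha), Function.update_of_ne (hne b hb)] at hab
        exact hg ha hb hab
    · intro i hi
      rcases Finset.mem_insert.1 hi with rfl | hi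
      · rwa [Function.update_self]
      · rw [Function.update_of_ne (hne i hi)]
        exact hgS i hi

open Metric Set Filter Topology in
/-- Finitely many small balls cover the sphere, and each of them is assigned its own point of a
prescribed small ball whose angular distances from the points of the covering ball avoid `F`. -/
theorem exists_finite_cover_angularDist_notMem {n : ℕ} (hn : 1 ≤ n) {F : Set ℝ} (hF : F.Finite)
    (p : UnitSphere n) {ρ : ℝ} (hρ : 0 < ρ) :
    ∃ (t : Finset (UnitSphere n)) (N : UnitSphere n → UnitSphere n) (δ : UnitSphere n → ℝ),
      (∀ y, ∃ x ∈ t, y ∈ ball x (δ x)) ∧ InjOn N t ∧ (∀ x, 0 < δ x) ∧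
      ∀ x ∈ t, N x ∈ ball p ρ ∧ ∀ y ∈ closedBall x (δ x), angularDist y (N x) ∉ F := by
  have h1 : ∀ x : UnitSphere n, ∃ N ∈ ball p ρ, angularDist x N ∉ F := fun x =>
    exists_angularDist_notMem_of_isOpen hn hF x isOpen_ball ⟨p, mem_ball_self hρ⟩
  choose N₀ hN₀ hxN₀ using h1
  have h2 : ∀ x : UnitSphere n, ∃ δ > 0, ∀ q ∈ closedBall (x, N₀ x) δ,
      angularDist q.1 q.2 ∉ F := by
    intro x
    have hmem : {q : UnitSphere n × UnitSphere n | angularDist q.1 q.2 ∉ F} ∈ 𝓝 (x, N₀ x) :=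
      (hF.isClosed.isOpen_compl.preimage continuous_angularDist).mem_nhds (hxN₀ x)
    exact Metric.nhds_basis_closedBall.mem_iff.1 hmem
  choose δ hδ hδF using h2
  obtain ⟨t, ht⟩ := isCompact_univ.elim_finite_subcover (fun x : UnitSphere n => ball x (δ x))
    (fun _ => isOpen_ball) fun x _ => mem_iUnion.2 ⟨x, mem_ball_self (hδ x)⟩
  have : Nonempty (UnitSphere n) := ⟨p⟩
  obtain ⟨N, hNinj, hN⟩ := t.exists_injOn_forall_mem_of_infinite
    (fun x => ball (N₀ x) (δ x) ∩ ball p ρ) fun x _ =>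
      UnitSphere.infinite_of_isOpen hn (isOpen_ball.inter isOpen_ball)
        ⟨N₀ x, mem_ball_self (hδ x), hN₀ x⟩
  refine ⟨t, N, δ, fun y => ?_, hNinj, hδ, fun x hx => ⟨(hN x hx).2, fun y hy => ?_⟩⟩
  · simpa using ht (mem_univ y)
  · exact hδF x (y, N x) (by
      rw [← closedBall_prod_same]
      exact ⟨hy, ball_subset_closedBall (hN x hx).1⟩)

/-! ### Obstruction to paths, and separation from the curves -/

open Set in
/-- A path that meets the range of `f` only at its endpoints cannot start at an interior point of
the range, unless its endpoints agree. -/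
theorem eq_of_path_range_inter_range {m : ℕ} {X : Type*} {f : X → EuclideanSpace ℝ (Fin m)}
    {y z : EuclideanSpace ℝ (Fin m)} (hy : y ∈ interior (range f)) (γ : Path y z)
    (hγ : range γ ∩ range f = {y, z}) : y = z := by
  by_contra hne
  -- The fibre over `y` is closed, and this description makes it open too; `[0, 1]` is connected.
  have hpre : γ ⁻¹' {y} = γ ⁻¹' (interior (range f) \ {z}) := by
    ext s
    simp only [mem_preimage, mem_singleton_iff, mem_sdiff]
    constructor
    · intro h
      rw [h]
      exact ⟨hy, hne⟩
    · rintro ⟨h, hz⟩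
      have : γ s ∈ range γ ∩ range f := ⟨⟨s, rfl⟩, interior_subset h⟩
      rw [hγ] at this
      exact this.resolve_right hz
  have hclopen : IsClopen (γ ⁻¹' {y}) := by
    refine ⟨isClosed_singleton.preimage γ.continuous, ?_⟩
    rw [hpre]
    exact (isOpen_interior.sdiff isClosed_singleton).preimage γ.continuous
  have huniv := hclopen.eq_univ ⟨0, γ.source⟩
  have : (1 : unitInterval) ∈ γ ⁻¹' {y} := huniv ▸ mem_univ _
  exact hne (by simpa using this.symm)

open Metric Set Filter Topology in
/-- If the curve `Γ` misses every point of the sphere whose angular distance from `N` is in `F`,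
then a uniform version of this holds for all points near `N`. -/
theorem eventually_lt_dist_of_angularDist_mem {n : ℕ} {F : Set ℝ} (hF : IsClosed F)
    (N : UnitSphere n) {Γ : ℝ → EuclideanSpace ℝ (Fin (n + 1))} (hΓ : Continuous Γ)
    (h : ∀ s ∈ Icc (0 : ℝ) 1, ∀ b : UnitSphere n, angularDist N b ∈ F → Γ s ≠ b) :
    ∀ᶠ ε in 𝓝[>] (0 : ℝ), ∀ a b : UnitSphere n, dist a N ≤ ε → angularDist a b ∈ F →
      ∀ s ∈ Icc (0 : ℝ) 1, ε < dist (Γ s) b := by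
  let K : Set ((UnitSphere n × UnitSphere n) × ℝ) :=
    {q : UnitSphere n × UnitSphere n | angularDist q.1 q.2 ∈ F} ×ˢ Icc 0 1
  have hK : IsCompact K := (hF.preimage continuous_angularDist).isCompact.prod isCompact_Icc
  obtain ⟨c, hc, hcK⟩ := hK.exists_forall_le' (a := (0 : ℝ))
    (f := fun q : (UnitSphere n × UnitSphere n) × ℝ => max (dist q.1.1 N) (dist (Γ q.2) q.1.2))
    (Continuous.continuousOn (by fun_prop)) (by
      rintro ⟨⟨a, b⟩, s⟩ ⟨hab, hs⟩
      by_contra hle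
      have hle := not_lt.1 hle
      have ha : a = N := dist_le_zero.1 ((le_max_left _ _).trans hle)
      have hb : Γ s = b := dist_le_zero.1 ((le_max_right _ _).trans hle)
      exact h s hs b (ha ▸ hab) hb)
  filter_upwards [Ioo_mem_nhdsGT hc] with ε hε a b ha hab s hs
  rcases le_max_iff.1 (hcK ((a, b), s) ⟨hab, hs⟩) with h' | h'
  · exact (not_lt.2 (h'.trans ha) hε.2).elim
  · exact hε.2.trans_le h'

/-! ### Stretching a cap along a curve -/

/-- The displacement that, added to the identity near `N`, first contracts an annulus around `N` to
`N` and then moves the points of the remaining small ball along the curve `Γ`. -/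
noncomputable def capDisplacement {V : Type*} [NormedAddCommGroup V] [NormedSpace ℝ V] (N : V)
    (Γ : ℝ → V) (ε : ℝ) (a : V) : V :=
  Γ (max 0 (1 - 2 * dist a N / ε)) - N - max 0 (min 1 (2 - 2 * dist a N / ε)) • (a - N)

section capDisplacement

variable {V : Type*} [NormedAddCommGroup V] [NormedSpace ℝ V] {N : V} {Γ : ℝ → V} {ε : ℝ} {a : V}

theorem continuous_capDisplacement (hΓ : Continuous Γ) : Continuous (capDisplacement N Γ ε) := by
  unfold capDisplacement
  fun_prop

theorem capDisplacement_of_le (hε : 0 < ε) (h0 : Γ 0 = N) (ha : ε ≤ dist a N) :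
    capDisplacement N Γ ε a = 0 := by
  have h : 2 ≤ 2 * dist a N / ε := by
    rw [le_div_iff₀ hε]
    linarith
  rw [capDisplacement, max_eq_left (by linarith),
    max_eq_left ((min_le_right _ _).trans (by linarith)), h0]
  simp

/-- The image of `a` differs from a point of the curve by a multiple of `a - N` with factor in `[0,
1]`, so separation from the curve passes to the image. -/
theorem exists_dist_add_capDisplacement_le (hε : 0 < ε) :
    ∃ s ∈ Set.Icc (0 : ℝ) 1, dist (Γ s) (a + capDisplacement N Γ ε a) ≤ dist a N := by
  have h : 0 ≤ 2 * dist a N / ε := by positivity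
  refine ⟨_, ⟨le_max_left 0 (1 - 2 * dist a N / ε), max_le zero_le_one (by linarith)⟩, ?_⟩
  set c := max 0 (min 1 (2 - 2 * dist a N / ε)) with hc
  have hc0 : 0 ≤ c := le_max_left _ _
  have hc1 : c ≤ 1 := max_le zero_le_one (min_le_left _ _)
  have heq : a + capDisplacement N Γ ε a - Γ (max 0 (1 - 2 * dist a N / ε)) =
      (1 - c) • (a - N) := by
    rw [capDisplacement, ← hc]
    module
  rw [dist_comm, dist_eq_norm, heq, norm_smul, Real.norm_of_nonneg (by linarith), ← dist_eq_norm]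
  exact mul_le_of_le_one_left dist_nonneg (by linarith)

/-- In the inner half of the cap the term `a - N` cancels, leaving the curve alone. -/
theorem add_capDisplacement_eq {s : ℝ} (hε : 0 < ε) (hs : 0 ≤ s)
    (ha : dist a N = (1 - s) * ε / 2) : a + capDisplacement N Γ ε a = Γ s := by
  have h : 2 * dist a N / ε = 1 - s := by
    rw [ha]
    field_simp
  rw [capDisplacement, h, sub_sub_cancel, max_eq_right hs, min_eq_left (by linarith),
    max_eq_right zero_le_one]
  module

end capDisplacement

/-! ### Assembly of the map -/

/-- On the sphere, a segment between two points meets the sphere only at its endpoints. -/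
theorem UnitSphere.eq_or_eq_of_mem_segment {n : ℕ} {p x b : UnitSphere n}
    (hb : (b : EuclideanSpace ℝ (Fin (n + 1))) ∈
      segment ℝ (p : EuclideanSpace ℝ (Fin (n + 1))) x) : b = p ∨ b = x := by
  by_contra! hne
  have hpx : (p : EuclideanSpace ℝ (Fin (n + 1))) ≠ x := by
    intro h
    rw [h, segment_same] at hb
    exact hne.2 (Subtype.ext hb)
  have hop := mem_openSegment_of_ne_left_right (fun h => hne.1 (Subtype.ext h.symm))
    (fun h => hne.2 (Subtype.ext h.symm)) hb
  have := openSegment_subset_ball_of_ne (Metric.sphere_subset_closedBall p.2)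
    (Metric.sphere_subset_closedBall x.2) hpx hop
  rw [mem_ball_zero_iff, b.norm_coe] at this
  exact lt_irrefl _ this

open Metric Set Filter Topology in
theorem mainTheorem7 (n : ℕ) (hn : 1 ≤ n) (F : Set ℝ) (hF : F.Finite) :
    ∃ f : UnitSphere n → EuclideanSpace ℝ (Fin (n + 1)),
      Continuous f ∧ F ∩ topologicalNeighborDistances angularDist f = ∅ := by
  -- Neighbors are distinct, so the distance `0` never occurs; removing it lets points near `p`
  -- avoid `G`.
  set G : Set ℝ := F \ {0} with hG
  have hGfin : G.Finite := hF.sdiff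
  have hG0 : (0 : ℝ) ∉ G := fun h => h.2 rfl
  let p : UnitSphere n := ⟨EuclideanSpace.single 0 1, by simp⟩
  obtain ⟨ρ, hρ, hsmall⟩ : ∃ ρ > 0, ∀ a ∈ ball p ρ, ∀ b ∈ ball p ρ, angularDist a b ∉ G := by
    have hmem : {q : UnitSphere n × UnitSphere n | angularDist q.1 q.2 ∉ G} ∈ 𝓝 (p, p) :=
      (hGfin.isClosed.isOpen_compl.preimage continuous_angularDist).mem_nhds
        (by simpa [angularDist_self] using hG0)
    obtain ⟨ρ, hρ, h⟩ := Metric.mem_nhds_iff.1 hmem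
    refine ⟨ρ, hρ, fun a ha b hb => h (a := (a, b)) ?_⟩
    rw [← ball_prod_same]
    exact ⟨ha, hb⟩
  obtain ⟨t, N, δ, hcover, hinj, hδ, hN⟩ :=
    exists_finite_cover_angularDist_notMem hn hGfin p hρ
  choose Γ hΓ hΓ0 hfill hrange using fun x : UnitSphere n =>
    exists_continuous_filling_closedBall (N x : EuclideanSpace ℝ (Fin (n + 1))) x (hδ x)
  have hmiss : ∀ x ∈ t, ∀ s ∈ Icc (0 : ℝ) 1, ∀ b : UnitSphere n,
      angularDist (N x) b ∈ G → Γ x s ≠ b := by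
    intro x hx s hs b hb hsb
    rw [angularDist_comm] at hb
    have hmem := hrange x ⟨s, hsb⟩
    have hball : b ∉ closedBall x (δ x) := fun h => (hN x hx).2 b h hb
    rcases hmem with h | h
    · rcases UnitSphere.eq_or_eq_of_mem_segment h with rfl | rfl
      · rw [angularDist_self] at hb
        exact hG0 hb
      · exact hball (mem_closedBall_self (hδ b).le)
    · exact hball h
  -- The bound `2` ensures that points at each distance `(1 - s) * ε / 2` from `N x` exist on the
  -- sphere.
  have hev : ∀ᶠ ε in 𝓝[>] (0 : ℝ), (0 < ε ∧ ε < 2) ∧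
      (∀ x ∈ t, ∀ a b : UnitSphere n, dist a (N x) ≤ ε → angularDist a b ∈ G →
        ∀ s ∈ Icc (0 : ℝ) 1, ε < dist (Γ x s) b) ∧
      (∀ x ∈ t, ∀ y ∈ t, x ≠ y → 2 * ε < dist (N x) (N y)) ∧
      ∀ x ∈ t, ε + dist (N x) p < ρ := by
    have hlt : ∀ c : ℝ, 0 < c → ∀ᶠ ε in 𝓝[>] (0 : ℝ), ε < c := fun c hc =>
      mem_of_superset (Ioo_mem_nhdsGT hc) fun _ h => h.2
    refine Filter.Eventually.and (Ioo_mem_nhdsGT two_pos)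
      (Filter.Eventually.and ?_ (Filter.Eventually.and ?_ ?_))
    · exact (eventually_all_finset t).2 fun x hx =>
        eventually_lt_dist_of_angularDist_mem hGfin.isClosed (N x) (hΓ x) (hmiss x hx)
    · refine (eventually_all_finset t).2 fun x hx => (eventually_all_finset t).2 fun y hy => ?_
      by_cases hxy : x = y
      · exact .of_forall fun _ h => (h hxy).elim
      · have : 0 < dist (N x) (N y) := dist_pos.2 fun h => hxy (hinj hx hy h)
        filter_upwards [hlt _ (half_pos this)] with ε hε _
        linarith
    · refine (eventually_all_finset t).2 fun x hx => ?_
      filter_upwards [hlt (ρ - dist (N x) p) (sub_pos.2 (hN x hx).1)] with ε hε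
      linarith
  obtain ⟨ε, ⟨hε, hε2⟩, hsep, hdisj, hcap⟩ := hev.exists
  let f : UnitSphere n → EuclideanSpace ℝ (Fin (n + 1)) := fun a =>
    a + ∑ x ∈ t, capDisplacement (N x : EuclideanSpace ℝ (Fin (n + 1))) (Γ x) ε a
  have hfc : Continuous f := by
    refine continuous_subtype_val.add (continuous_finsetSum _ fun x _ => ?_)
    exact (continuous_capDisplacement (hΓ x)).comp continuous_subtype_val
  have hout : ∀ a : UnitSphere n, (∀ x ∈ t, ε ≤ dist a (N x)) → f a = a := by
    intro a ha
    simp only [f]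
    rw [Finset.sum_eq_zero fun x hx => capDisplacement_of_le hε (hΓ0 x) (ha x hx), add_zero]
  have hin : ∀ a : UnitSphere n, ∀ x ∈ t, dist a (N x) < ε → f a =
      a + capDisplacement (N x : EuclideanSpace ℝ (Fin (n + 1))) (Γ x) ε a := by
    intro a x hx ha
    simp only [f]
    rw [Finset.sum_eq_single_of_mem x hx fun y hy hyx => capDisplacement_of_le hε (hΓ0 y) ?_]
    have h1 := hdisj x hx y hy hyx.symm
    have h2 := dist_triangle_left (N x) (N y) a
    change ε ≤ dist a (N y)
    linarith
  have hfilled : ∀ x ∈ t, closedBall (x : EuclideanSpace ℝ (Fin (n + 1))) (δ x) ⊆ range f := by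
    intro x hx y hy
    obtain ⟨s, ⟨hs0, hs1⟩, rfl⟩ := hfill x hy
    obtain ⟨a, ha⟩ := UnitSphere.exists_dist_eq hn (N x) (r := (1 - s) * ε / 2)
      (div_nonneg (mul_nonneg (sub_nonneg.2 hs1) hε.le) two_pos.le) (by nlinarith)
    refine ⟨a, ?_⟩
    rw [hin a x hx (by rw [ha]; nlinarith), add_capDisplacement_eq hε hs0 ha]
  have hinterior : ∀ a : UnitSphere n, (∀ x ∈ t, ε ≤ dist a (N x)) →
      f a ∈ interior (range f) := by
    intro a ha
    obtain ⟨x, hx, hax⟩ := hcover a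
    rw [hout a ha]
    exact mem_interior.2 ⟨_, ball_subset_closedBall.trans (hfilled x hx), isOpen_ball, hax⟩
  have hne_of_mem : ∀ a b : UnitSphere n, angularDist a b ∈ G → ∀ x ∈ t, dist a (N x) < ε →
      (∀ y ∈ t, ε ≤ dist b (N y)) → f a ≠ f b := by
    intro a b hab x hx ha hb hfab
    obtain ⟨s, hs, hle⟩ := exists_dist_add_capDisplacement_le (Γ := Γ x)
      (N := (N x : EuclideanSpace ℝ (Fin (n + 1)))) (a := a) hε
    rw [← hin a x hx ha, hfab, hout b hb] at hle
    exact absurd (hsep x hx a b ha.le hab s hs) (not_lt.2 (hle.trans ha.le))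
  refine ⟨f, hfc, eq_empty_iff_forall_notMem.2 ?_⟩
  rintro r ⟨hrF, a, b, ⟨hab, hnb⟩, rfl⟩
  have hr : angularDist a b ∈ G := ⟨hrF, fun h => hab (eq_of_angularDist_eq_zero h)⟩
  have hball : ∀ a : UnitSphere n, (∃ x ∈ t, dist a (N x) < ε) → a ∈ ball p ρ := by
    rintro a ⟨x, hx, ha⟩
    have h1 := hcap x hx
    have h2 := dist_triangle a (N x) p
    exact mem_ball.2 (by linarith)
  -- So at least one of `a`, `b` is outside the caps, and the path argument starts there.
  have hnot : ¬ ((∃ x ∈ t, dist a (N x) < ε) ∧ ∃ x ∈ t, dist b (N x) < ε) := fun h =>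
    hsmall a (hball a h.1) b (hball b h.2) hr
  have hfne : f a ≠ f b := by
    by_cases ha : ∃ x ∈ t, dist a (N x) < ε
    · have hb : ∀ x ∈ t, ε ≤ dist b (N x) := by
        by_contra! hb
        exact hnot ⟨ha, hb⟩
      obtain ⟨x, hx, hax⟩ := ha
      exact hne_of_mem a b hr x hx hax hb
    · by_cases hb : ∃ x ∈ t, dist b (N x) < ε
      · push Not at ha
        obtain ⟨x, hx, hbx⟩ := hb
        exact (hne_of_mem b a (angularDist_comm a b ▸ hr) x hx hbx ha).symm
      · push Not at ha hb
        rw [hout a ha, hout b hb]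
        exact fun h => hab (Subtype.ext h)
  rcases hnb with h | ⟨γ, hγ⟩
  · exact hfne h
  · by_cases ha : ∃ x ∈ t, dist a (N x) < ε
    · have hb : ∀ x ∈ t, ε ≤ dist b (N x) := by
        by_contra! hb
        exact hnot ⟨ha, hb⟩
      refine hfne (eq_of_path_range_inter_range (hinterior b hb) γ.symm ?_).symm
      rw [Path.symm_range, hγ, pair_comm]
    · push Not at ha
      exact hfne (eq_of_path_range_inter_range (hinterior a ha) γ hγ)
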